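/- For a family $\mathcal F$ of graphs, the $\mathcal F$-saturation game on $n$ vertices is played by two players, Max and Mini, starting from the empty graph on $n$ vertices. Beginning with Max, the players alternately add a new edge to the graph, subject to the condition that the resulting graph contains no subgraph isomorphic to a member of $\mathcal F$; the game ends when no such edge exists. Max wants the number of edges of the final graph to be as large as possible, Mini wants it to be as small as possible, and $\mathrm{sat}_g(n,\mathcal F)$ denotes the number of edges of the final graph when both players play optimally. Let $\mathcal C^o_{\ge m}$ be the family of all odd cycles of length at least $m$. Then for all integers $k\ge 2$ and $n\ge 1$, $$\mathrm{sat}_g(n,\mathcal C^o_{\ge 2k+1})\le (3k+1)(n-1).$$ -/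

import Mathlib

/-- A family of finite graphs, each member taken (up to isomorphism) on a vertex set `Fin m`. -/
abbrev GraphFamily : Type := Set (Σ m : ℕ, SimpleGraph (Fin m))

/-- The family of all odd cycles `C_ℓ` of length `ℓ ≥ k` (a cycle has length at least `3`). -/
def oddCyclesGE (k : ℕ) : GraphFamily :=
  {F | ∃ ℓ : ℕ, 3 ≤ ℓ ∧ k ≤ ℓ ∧ Odd ℓ ∧ F = ⟨ℓ, SimpleGraph.cycleGraph ℓ⟩}

/-- `G` has no (not necessarily induced) subgraph isomorphic to a member of `𝓕`. -/
def FamilyFree {V : Type*} (𝓕 : GraphFamily) (G : SimpleGraph V) : Prop :=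
  ∀ F ∈ 𝓕, ¬ SimpleGraph.IsContained F.2 G

/-- `H` arises from `G` by a legal move of the `𝓕`-saturation game: a single new edge is added,
and no member of `𝓕` is created. -/
def LegalMove {V : Type*} (𝓕 : GraphFamily) (G H : SimpleGraph V) : Prop :=
  ∃ u v : V, u ≠ v ∧ ¬ G.Adj u v ∧ H = G ⊔ SimpleGraph.edge u v ∧ FamilyFree 𝓕 H

theorem LegalMove.lt {V : Type*} {𝓕 : GraphFamily} {G H : SimpleGraph V}
    (h : LegalMove 𝓕 G H) : G < H := by
  obtain ⟨u, v, huv, hn, rfl, -⟩ := h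
  refine lt_of_le_of_ne le_sup_left fun he => hn ?_
  rw [he]
  simp [SimpleGraph.edge_adj, huv]

theorem LegalMove.ncard_compl_lt {V : Type*} [Finite V] {𝓕 : GraphFamily} {G H : SimpleGraph V}
    (h : LegalMove 𝓕 G H) : (Hᶜ).edgeSet.ncard < (Gᶜ).edgeSet.ncard :=
  Set.ncard_lt_ncard (SimpleGraph.edgeSet_ssubset_edgeSet.2 (compl_lt_compl_iff_lt.2 h.lt))
    (Set.toFinite _)

/-- The two players: `max` wants many edges in the final graph, `mini` wants few. -/
inductive Player : Type
  | max
  | mini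

open Classical in
/-- The number of edges of the final graph when the `𝓕`-saturation game is continued from
position `G` with player `p` to move and both players play optimally. The game is over when
there is no legal move; otherwise the player to move must add an edge. -/
noncomputable def gameScore {V : Type*} [Finite V] (𝓕 : GraphFamily) (p : Player)
    (G : SimpleGraph V) : ℕ :=
  if ∃ H, LegalMove 𝓕 G H then
    match p with
    | Player.max => ⨆ H : {H : SimpleGraph V // LegalMove 𝓕 G H}, gameScore 𝓕 Player.mini H.1
    | Player.mini => ⨅ H : {H : SimpleGraph V // LegalMove 𝓕 G H}, gameScore 𝓕 Player.max H.1
  else G.edgeSet.ncard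
termination_by (Gᶜ).edgeSet.ncard
decreasing_by
  all_goals exact H.2.ncard_compl_lt

/-- The game saturation number `sat_g(n, 𝓕)`: the game starts from the empty graph on `n`
vertices, and Max moves first. -/
noncomputable def gameSaturationNumber (n : ℕ) (𝓕 : GraphFamily) : ℕ :=
  gameScore 𝓕 Player.max (⊥ : SimpleGraph (Fin n))

/-
Call the edges of the position that lie on no odd cycle its even part. Mini can keep every trail of
the even part of length at most three: Max's move adds at most one edge to it, and Mini answers by
joining the ends of two consecutive edges of the even part, which puts both on a triangle and so
removes them from it; the same bound shows that this closes no long odd cycle.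

In the final graph, odd cycles have length less than `2k + 1`, and even cycles have length less than
`4k`. Indeed, an even cycle of length at least `4k` has an edge outside the even part. An odd cycle
through that edge provides a path, internally disjoint from the even cycle, whose length has the
wrong parity for its ends. With the two arcs of the even cycle it forms two odd cycles that together
are longer than the even cycle, so one of them has length at least `2k + 1`.

Finally, a neighbour of the start of a longest path lies on this path, and the lengths of the cycles
so closed leave room for at most `3k - 2` neighbours. The same holds in every induced subgraph, so
the final graph is `(3k - 2)`-degenerate.
-/

open SimpleGraph

variable {V : Type*} {G H : SimpleGraph V}

theorem familyFree_oddCyclesGE_iff {m : ℕ} :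
    FamilyFree (oddCyclesGE m) G ↔
      ∀ (u : V) (c : G.Walk u u), c.IsCycle → Odd c.length → c.length < m := by
  constructor
  · intro hG u c hc hodd
    by_contra! hlen
    exact hG _ ⟨_, hc.three_le_length, hlen, hodd, rfl⟩
      ((cycleGraph_isContained_iff hc.three_le_length).2 ⟨u, c, hc, rfl⟩)
  · rintro hG _ ⟨ℓ, h3, hm, hodd, rfl⟩ hcont
    obtain ⟨u, c, hc, rfl⟩ := (cycleGraph_isContained_iff h3).1 hcont
    exact (hG u c hc hodd).not_ge hm

theorem exists_isPath_perm_edges_of_isCycle {r a b : V} {c : G.Walk r r} (hc : c.IsCycle)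
    (h : s(a, b) ∈ c.edges) :
    ∃ p : G.Walk b a, p.IsPath ∧ s(a, b) ∉ p.edges ∧ c.edges.Perm (s(a, b) :: p.edges) := by
  classical
  obtain ⟨d, hd, rfl, hperm⟩ :
      ∃ d : G.Walk a a, d.IsCycle ∧ d.snd = b ∧ c.edges.Perm d.edges := by
    have ha := c.fst_mem_support_of_mem_edges h
    have hrot := hc.rotate ha
    have hperm := (c.rotate_edges a ha).perm
    have hb : b ∈ (c.rotate a ha).toSubgraph.neighborSet a :=
      Walk.adj_toSubgraph_iff_mem_edges.2 (hperm.mem_iff.2 h)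
    rw [hrot.neighborSet_toSubgraph_endpoint] at hb
    rcases hb with rfl | rfl
    · exact ⟨_, hrot, rfl, hperm.symm⟩
    · refine ⟨_, hrot.reverse, Walk.snd_reverse _, ?_⟩
      rw [Walk.edges_reverse]
      exact (hperm.symm.trans (List.reverse_perm _).symm)
  rw [← d.cons_tail_eq hd.not_nil, Walk.edges_cons] at hperm
  have hnodup := hperm.nodup_iff.1 hc.isTrail.edges_nodup
  exact ⟨d.tail, hd.isPath_tail, (List.nodup_cons.1 hnodup).1, hperm⟩

theorem exists_bipartition_of_even_isCycle {r : V} {c : G.Walk r r} (hc : c.IsCycle)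
    (heven : Even c.length) :
    ∃ A : Set V, ∀ {x y : V} (p : G.Walk x y), p.edges ⊆ c.edges →
      (Even p.length ↔ (x ∈ A ↔ y ∈ A)) := by
  have hcolour {i j : ℕ} (hi : i ≤ c.length) (hj : j ≤ c.length)
      (h : c.getVert i = c.getVert j) : Even i ↔ Even j := by
    have := hc.getVert_injOn' (x₁ := i) (x₂ := j)
    have := hc.getVert_injOn (x₁ := i) (x₂ := j)
    simp only [Set.mem_ofPred] at *
    grind
  refine ⟨{z | ∃ i ≤ c.length, Even i ∧ c.getVert i = z}, fun p hp => ?_⟩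
  have hA {i : ℕ} (hi : i ≤ c.length) :
      c.getVert i ∈ {z | ∃ i ≤ c.length, Even i ∧ c.getVert i = z} ↔ Even i :=
    ⟨fun ⟨j, hj, hje, h⟩ => (hcolour hj hi h).1 hje, fun h => ⟨i, hi, h, rfl⟩⟩
  generalize {z | ∃ i ≤ c.length, Even i ∧ c.getVert i = z} = A at hA
  induction p with
  | nil => simp
  | @cons x y z hxy p ih =>
    rw [Walk.edges_cons, List.cons_subset] at hp
    obtain ⟨i, hi, he⟩ := (c.mk_mem_edges_iff_exists).1 hp.1
    have h0 := hA hi.le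
    have h1 := hA (Nat.succ_le_of_lt hi)
    have := ih hp.2
    rw [Walk.length_cons]
    grind

theorem exists_ear_of_isPath {S A : Set V} {a b : V} {p : G.Walk a b} (hp : p.IsPath)
    (ha : a ∈ S) (hb : b ∈ S) (hpar : ¬(Even p.length ↔ (a ∈ A ↔ b ∈ A))) :
    ∃ x ∈ S, ∃ y ∈ S, ∃ q : G.Walk x y, q.IsPath ∧ (∀ z ∈ q.support, z ∈ S → z = x ∨ z = y) ∧
      ¬(Even q.length ↔ (x ∈ A ↔ y ∈ A)) := by
  classical
  induction hn : p.length using Nat.strong_induction_on generalizing a b with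
  | _ n ih =>
  by_cases hS : ∀ z ∈ p.support, z ∈ S → z = a ∨ z = b
  · exact ⟨a, ha, b, hb, p, hp, hS, hpar⟩
  push Not at hS
  obtain ⟨z, hzp, hz, hza, hzb⟩ := hS
  have hlen : (p.takeUntil z hzp).length + (p.dropUntil z hzp).length = p.length := by
    rw [← Walk.length_append, p.take_spec]
  by_cases hpre : Even (p.takeUntil z hzp).length ↔ (a ∈ A ↔ z ∈ A)
  · refine ih _ ?_ (hp.dropUntil hzp) hz hb ?_ rfl
    · exact hn ▸ p.length_dropUntil_lt_length hzp hza
    · grind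
  · exact ih _ (hn ▸ p.length_takeUntil_lt_length hzp hzb) (hp.takeUntil hzp) ha hz hpre rfl

theorem isCycle_append_of_odd {x y : V} (hxy : x ≠ y) {p : G.Walk x y} {q : G.Walk y x}
    (hp : p.IsPath) (hq : q.IsPath) (hpq : ∀ z ∈ p.support, z ∈ q.support → z = x ∨ z = y)
    (hodd : Odd (p.append q).length) : (p.append q).IsCycle := by
  have hstart {u v : V} {w : G.Walk u v} (hw : w.IsPath) : u ∉ w.support.tail :=
    (List.nodup_cons.1 (w.cons_tail_support.symm ▸ hw.support_nodup)).1
  have hp0 : p.length ≠ 0 := fun h => hxy (Walk.eq_of_length_eq_zero h)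
  have hq0 : q.length ≠ 0 := fun h => hxy (Walk.eq_of_length_eq_zero h).symm
  rw [Walk.length_append] at hodd
  refine hp.isCycle_append hq (fun z hzp hzq => ?_) (by grind)
  rcases hpq z (List.mem_of_mem_tail hzp) (List.mem_of_mem_tail hzq) with rfl | rfl
  · exact hstart hp hzp
  · exact hstart hq hzq

/-- The edge `e` lies on an odd cycle of `G`. -/
def OnOddCycle (G : SimpleGraph V) (e : Sym2 V) : Prop :=
  ∃ (u : V) (c : G.Walk u u), c.IsCycle ∧ Odd c.length ∧ e ∈ c.edges

theorem exists_odd_isCycle_cover_of_ear {A : Set V} {x y : V} {c : G.Walk x x} (hc : c.IsCycle)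
    (hy : y ∈ c.support)
    (hA : ∀ {a b : V} (p : G.Walk a b), p.edges ⊆ c.edges → (Even p.length ↔ (a ∈ A ↔ b ∈ A)))
    {q : G.Walk x y} (hq : q.IsPath) (hqc : ∀ z ∈ q.support, z ∈ c.support → z = x ∨ z = y)
    (hpar : ¬(Even q.length ↔ (x ∈ A ↔ y ∈ A))) :
    ∃ d₁ d₂ : G.Walk x x, (d₁.IsCycle ∧ Odd d₁.length) ∧ (d₂.IsCycle ∧ Odd d₂.length) ∧
      c.length < d₁.length + d₂.length ∧ ∀ e ∈ c.edges, e ∈ d₁.edges ∨ e ∈ d₂.edges := by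
  classical
  have hxy : x ≠ y := by
    rintro rfl
    simp [Walk.length_eq_zero_iff.2 (Walk.isPath_iff_nil.1 hq)] at hpar
  have hspec := c.take_spec hy
  have htake : (c.takeUntil y hy).IsPath := hc.isPath_takeUntil hy
  have hdrop : (c.dropUntil y hy).IsPath :=
    Walk.IsCycle.isPath_of_append_right (Walk.not_nil_of_ne hxy) (hspec.symm ▸ hc)
  have hclose {s : G.Walk y x} (hs : s.IsPath) (hse : s.edges ⊆ c.edges)
      (hss : s.support ⊆ c.support) : (q.append s).IsCycle ∧ Odd (q.append s).length := by
    have hodd : Odd (q.append s).length := by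
      have := hA s hse
      rw [Walk.length_append]
      grind
    exact ⟨isCycle_append_of_odd hxy hq hs (fun z hzq hzs => hqc z hzq (hss hzs)) hodd, hodd⟩
  have hlen : (c.takeUntil y hy).length + (c.dropUntil y hy).length = c.length := by
    rw [← Walk.length_append, hspec]
  have hq0 : q.length ≠ 0 := fun h => hxy (Walk.eq_of_length_eq_zero h)
  refine ⟨_, _, hclose hdrop (c.edges_dropUntil_subset_edges hy)
    (c.support_dropUntil_subset_support hy), hclose htake.reverse ?_ ?_, ?_, fun e he => ?_⟩
  · simpa using c.edges_takeUntil_subset_edges hy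
  · simpa using c.support_takeUntil_subset_support hy
  · simp only [Walk.length_append, Walk.length_reverse]
    omega
  · rw [← hspec, Walk.edges_append, List.mem_append] at he
    simp only [Walk.edges_append, Walk.edges_reverse, List.mem_append, List.mem_reverse]
    tauto

theorem exists_odd_isCycle_cover_of_even_isCycle {r : V} {c : G.Walk r r} (hc : c.IsCycle)
    (heven : Even c.length) {f : Sym2 V} (hf : f ∈ c.edges) (hodd : OnOddCycle G f) :
    ∃ (x : V) (d₁ d₂ : G.Walk x x), (d₁.IsCycle ∧ Odd d₁.length) ∧ (d₂.IsCycle ∧ Odd d₂.length) ∧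
      c.length < d₁.length + d₂.length ∧ ∀ e ∈ c.edges, e ∈ d₁.edges ∨ e ∈ d₂.edges := by
  classical
  obtain ⟨A, hA⟩ := exists_bipartition_of_even_isCycle hc heven
  obtain ⟨t, o, ho, holen, hfo⟩ := hodd
  induction f with | _ a b =>
  obtain ⟨p, hp, -, hop⟩ := exists_isPath_perm_edges_of_isCycle ho hfo
  have hpar : ¬(Even p.length ↔ (b ∈ A ↔ a ∈ A)) := by
    have hcons : o.length = p.length + 1 := by simpa using hop.length_eq
    have hedge := hA (Walk.cons (c.adj_of_mem_edges hf) Walk.nil) (by simpa using hf)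
    rw [Walk.length_cons, Walk.length_nil] at hedge
    grind
  obtain ⟨x, hx, y, hy, q, hq, hqS, hqpar⟩ :=
    exists_ear_of_isPath (S := {z | z ∈ c.support}) hp (c.snd_mem_support_of_mem_edges hf)
      (c.fst_mem_support_of_mem_edges hf) hpar
  have hedges {e : Sym2 V} : e ∈ (c.rotate x hx).edges ↔ e ∈ c.edges :=
    (c.rotate_edges x hx).perm.mem_iff
  obtain ⟨d₁, d₂, hd₁, hd₂, hlen, hcover⟩ := exists_odd_isCycle_cover_of_ear (hc.rotate hx)
    ((c.mem_support_rotate_iff x hx).2 hy) (fun p hp => hA p fun e he => hedges.1 (hp he)) hq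
    (fun z hzq hzc => hqS z hzq ((c.mem_support_rotate_iff x hx).1 hzc)) hqpar
  rw [Walk.length_rotate] at hlen
  exact ⟨x, d₁, d₂, hd₁, hd₂, hlen, fun e he => hcover e (hedges.2 he)⟩

theorem OnOddCycle.mono (h : G ≤ H) {e : Sym2 V} : OnOddCycle G e → OnOddCycle H e
  | ⟨u, c, hc, hodd, he⟩ => ⟨u, c.mapLe h, hc.mapLe h, by simpa using hodd, by simpa using he⟩

theorem onOddCycle_of_triangle {a b c : V} (hab : G.Adj a b) (hbc : G.Adj b c) (hca : G.Adj c a) :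
    OnOddCycle G s(a, b) := by
  refine ⟨a, .cons hab (.cons hbc (.cons hca .nil)), ?_, ⟨1, rfl⟩, List.mem_cons_self⟩
  rw [Walk.cons_isCycle_iff]
  simp [hab.ne, hab.ne', hca.ne, hca.ne', hbc.ne]

/-- The subgraph of `G` formed by the edges that lie on no odd cycle of `G`. Mini keeps this part
of the position sparse. -/
def evenPart (G : SimpleGraph V) : SimpleGraph V :=
  G.deleteEdges {e | OnOddCycle G e}

theorem evenPart_adj {a b : V} : (evenPart G).Adj a b ↔ G.Adj a b ∧ ¬OnOddCycle G s(a, b) :=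
  deleteEdges_adj

theorem mem_edgeSet_evenPart {e : Sym2 V} :
    e ∈ (evenPart G).edgeSet ↔ e ∈ G.edgeSet ∧ ¬OnOddCycle G e := by
  rw [evenPart, edgeSet_deleteEdges]
  rfl

theorem evenPart_le : evenPart G ≤ G :=
  deleteEdges_le _

theorem edges_subset_edgeSet_evenPart_of_isCycle {r : V} {c : G.Walk r r} (hc : c.IsCycle)
    {e : Sym2 V} (he : e ∈ c.edges) (hev : e ∈ (evenPart G).edgeSet) :
    ∀ f ∈ c.edges, f ∈ (evenPart G).edgeSet := by
  have hne := (mem_edgeSet_evenPart.1 hev).2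
  have heven : Even c.length := Nat.not_odd_iff_even.1 fun hodd => hne ⟨r, c, hc, hodd, he⟩
  refine fun f hf => mem_edgeSet_evenPart.2 ⟨c.edges_subset_edgeSet hf, fun hfodd => hne ?_⟩
  obtain ⟨x, d₁, d₂, hd₁, hd₂, -, hcover⟩ :=
    exists_odd_isCycle_cover_of_even_isCycle hc heven hf hfodd
  exact (hcover e he).elim (⟨x, d₁, hd₁.1, hd₁.2, ·⟩) (⟨x, d₂, hd₂.1, hd₂.2, ·⟩)

theorem exists_isCycle_evenPart {r : V} {d : G.Walk r r} (hd : d.IsCycle) {e : Sym2 V}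
    (he : e ∈ d.edges) (hev : e ∈ (evenPart G).edgeSet) :
    ∃ d' : (evenPart G).Walk r r, d'.IsCycle ∧ d'.edges = d.edges ∧ d'.support = d.support :=
  have hsub := edges_subset_edgeSet_evenPart_of_isCycle hd he hev
  ⟨d.transfer _ hsub, hd.transfer hsub, d.edges_transfer hsub, d.support_transfer hsub⟩

theorem four_le_length_of_isCycle_evenPart {r : V} {c : (evenPart G).Walk r r} (hc : c.IsCycle) :
    4 ≤ c.length := by
  have h3 := hc.three_le_length
  obtain ⟨e, he⟩ : ∃ e, e ∈ c.edges :=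
    List.exists_mem_of_length_pos (by rw [Walk.length_edges]; omega)
  have heven : ¬Odd c.length := fun hodd =>
    (mem_edgeSet_evenPart.1 (c.edges_subset_edgeSet he)).2
      ⟨r, c.mapLe evenPart_le, hc.mapLe _, by simpa using hodd, by simpa using he⟩
  grind

theorem deleteEdges_evenPart_sup_edge_le (u v : V) :
    (evenPart (G ⊔ edge u v)).deleteEdges {s(u, v)} ≤ evenPart G := by
  intro a b hab
  simp only [deleteEdges_adj, evenPart_adj, sup_adj, edge_adj, Set.mem_singleton_iff,
    Sym2.eq_iff] at hab
  exact evenPart_adj.2 ⟨by tauto, fun h => hab.1.2 (h.mono le_sup_left)⟩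

theorem evenPart_sup_edge_le_of_cherry {a b c : V} (hab : G.Adj a b) (hbc : G.Adj b c)
    (hac : a ≠ c) :
    evenPart (G ⊔ edge a c) ≤ (evenPart G).deleteEdges {s(a, b), s(b, c)} := by
  have hab' : (G ⊔ edge a c).Adj a b := .inl hab
  have hbc' : (G ⊔ edge a c).Adj b c := .inl hbc
  have hca' : (G ⊔ edge a c).Adj c a := .inr ((edge_adj ..).2 ⟨.inr ⟨rfl, rfl⟩, hac.symm⟩)
  have hodd_ab := onOddCycle_of_triangle hab' hbc' hca'
  have hodd_bc := onOddCycle_of_triangle hbc' hca' hab'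
  have hodd_ca := onOddCycle_of_triangle hca' hab' hbc'
  intro x y hxy
  rw [evenPart_adj] at hxy
  have hne : ∀ e, OnOddCycle (G ⊔ edge a c) e → s(x, y) ≠ e := fun e he h => hxy.2 (h ▸ he)
  have hG : G.Adj x y := by
    have := hne _ hodd_ca
    have := hxy.1
    simp only [sup_adj, edge_adj, ne_eq, Sym2.eq_iff] at *
    tauto
  refine deleteEdges_adj.2 ⟨evenPart_adj.2 ⟨hG, fun h => hxy.2 (h.mono le_sup_left)⟩, ?_⟩
  rintro (h | h)
  exacts [hne _ hodd_ab h, hne _ hodd_bc h]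

/-- Every trail of `G` has length at most `ℓ`. For `ℓ = 1` this says that `G` is a matching. -/
def TrailsLE (G : SimpleGraph V) (ℓ : ℕ) : Prop :=
  ∀ ⦃u v : V⦄ (p : G.Walk u v), p.IsTrail → p.length ≤ ℓ

theorem TrailsLE.anti {ℓ : ℕ} (h : G ≤ H) (hH : TrailsLE H ℓ) : TrailsLE G ℓ :=
  fun u v p hp => by simpa using hH (p.mapLe h) (hp.mapLe h)

theorem TrailsLE.length_le {ℓ : ℕ} {e : Sym2 V} (hG : TrailsLE (G.deleteEdges {e}) ℓ) {u v : V}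
    {p : G.Walk u v} (hp : p.IsTrail) (he : e ∉ p.edges) : p.length ≤ ℓ := by
  have htrail : (p.toDeleteEdge e he).IsTrail := by
    rw [Walk.isTrail_def, Walk.edges_transfer]
    exact hp.edges_nodup
  simpa using hG _ htrail

theorem exists_append_cons_of_mem_edges {u v : V} {p : G.Walk u v} {e : Sym2 V}
    (he : e ∈ p.edges) :
    ∃ (x y : V) (q : G.Walk u x) (h : G.Adj x y) (r : G.Walk y v),
      p = q.append (Walk.cons h r) ∧ s(x, y) = e := by
  induction p with
  | nil => simp at he
  | @cons u w v h p ih =>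
    rw [Walk.edges_cons, List.mem_cons] at he
    rcases he with rfl | he
    · exact ⟨u, w, .nil, h, p, rfl, rfl⟩
    · obtain ⟨x, y, q, h', r, rfl, hxy⟩ := ih he
      exact ⟨x, y, .cons h q, h', r, rfl, hxy⟩

theorem TrailsLE.two_mul_add_one {ℓ : ℕ} {e : Sym2 V} (hG : TrailsLE (G.deleteEdges {e}) ℓ) :
    TrailsLE G (2 * ℓ + 1) := by
  intro u v p hp
  by_cases he : e ∈ p.edges
  · obtain ⟨x, y, q, h, r, rfl, rfl⟩ := exists_append_cons_of_mem_edges he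
    have hnodup := hp.edges_nodup
    rw [Walk.edges_append, Walk.edges_cons, List.nodup_append, List.nodup_cons] at hnodup
    have hq := hG.length_le hp.of_append_left
      fun hmem => hnodup.2.2 _ hmem _ List.mem_cons_self rfl
    have hr := hG.length_le hp.of_append_right.of_cons hnodup.2.1.1
    rw [Walk.length_append, Walk.length_cons]
    omega
  · have := hG.length_le hp he
    omega

theorem TrailsLE.length_le_add_one_of_isCycle {ℓ : ℕ} {e : Sym2 V}
    (hG : TrailsLE (G.deleteEdges {e}) ℓ) {r : V} {c : G.Walk r r} (hc : c.IsCycle) :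
    c.length ≤ ℓ + 1 := by
  by_cases he : e ∈ c.edges
  · induction e with | _ a b =>
    obtain ⟨p, hp, hab, hperm⟩ := exists_isPath_perm_edges_of_isCycle hc he
    have hlen : c.length = p.length + 1 := by simpa using hperm.length_eq
    have := hG.length_le hp.isTrail hab
    omega
  · exact (hG.length_le hc.isTrail he).trans ℓ.le_succ

theorem TrailsLE.isAcyclic_of_le_evenPart (hle : H ≤ evenPart G) (hH : TrailsLE H 3) :
    H.IsAcyclic := by
  intro r c hc
  have h3 := hH c hc.isTrail
  have h4 := four_le_length_of_isCycle_evenPart (hc.mapLe hle)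
  rw [Walk.length_mapLe] at h4
  omega

theorem exists_cherry_of_isTrail {u v : V} {p : G.Walk u v} (hp : p.IsTrail) (h2 : 2 ≤ p.length)
    {e : Sym2 V} (he : e ∈ p.edges) :
    ∃ a b c : V, a ≠ c ∧ s(a, b) ∈ p.edges ∧ s(b, c) ∈ p.edges ∧ s(a, b) = e := by
  induction p with
  | nil => simp at he
  | @cons x y _ hxy p ih =>
    cases p with
    | nil => simp at h2
    | @cons _ z _ hyz r =>
      have hxz : x ≠ z := by
        rintro rfl
        simp [Sym2.eq_swap] at hp
      simp only [Walk.edges_cons, List.mem_cons] at he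
      rcases he with rfl | rfl | he
      · exact ⟨x, y, z, hxz, by simp, by simp, rfl⟩
      · exact ⟨z, y, x, hxz.symm, by simp [Sym2.eq_swap], by simp [Sym2.eq_swap], Sym2.eq_swap⟩
      · have hr := List.length_pos_of_mem he
        rw [Walk.length_edges] at hr
        obtain ⟨a, b, c, hac, hab, hbc, h⟩ := ih hp.of_cons
          (by rw [Walk.length_cons]; omega) (List.mem_cons_of_mem _ he)
        exact ⟨a, b, c, hac, List.mem_cons_of_mem _ hab, List.mem_cons_of_mem _ hbc, h⟩

theorem perm_edges_of_isCycle_of_isAcyclic_deleteEdges {e : Sym2 V}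
    (hG : (G.deleteEdges {e}).IsAcyclic) {r s : V} {c : G.Walk r r} {d : G.Walk s s}
    (hc : c.IsCycle) (hd : d.IsCycle) : c.edges.Perm d.edges := by
  have hmem {t : V} {w : G.Walk t t} (hw : w.IsCycle) : e ∈ w.edges :=
    by_contra fun he => hG (w.toDeleteEdge e he) (hw.transfer _)
  induction e with | _ a b =>
  obtain ⟨p, hp, hp_edge, hcp⟩ := exists_isPath_perm_edges_of_isCycle hc (hmem hc)
  obtain ⟨q, hq, hq_edge, hdq⟩ := exists_isPath_perm_edges_of_isCycle hd (hmem hd)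
  have hpq := congrArg (fun w => w.1.edges) <| (hG.subsingleton_path b a).elim
    ⟨p.toDeleteEdge _ hp_edge, hp.transfer _⟩ ⟨q.toDeleteEdge _ hq_edge, hq.transfer _⟩
  simp only [Walk.edges_transfer] at hpq
  exact (hpq ▸ hcp).trans hdq.symm

/-- The path `a b c` consists of two edges of the even part of `G` over which a triangle can be
closed: the cycles of the even part are so short and so concentrated on these two edges that the
edge `ac` creates no odd cycle other than triangles and the old ones. -/
structure ClosableCherry (G : SimpleGraph V) (a b c : V) : Prop where
  adj_left : (evenPart G).Adj a b
  adj_right : (evenPart G).Adj b c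
  ne : a ≠ c
  length_le : ∀ ⦃r : V⦄ (d : (evenPart G).Walk r r), d.IsCycle → d.length ≤ 4
  mem_edges : ∀ ⦃r : V⦄ (d : (evenPart G).Walk r r), d.IsCycle →
    s(a, b) ∈ d.edges ∧ s(b, c) ∈ d.edges

theorem ClosableCherry.symm {a b c : V} (h : ClosableCherry G a b c) : ClosableCherry G c b a where
  adj_left := h.adj_right.symm
  adj_right := h.adj_left.symm
  ne := h.ne.symm
  length_le := h.length_le
  mem_edges r d hd := by
    rw [Sym2.eq_swap (a := c), Sym2.eq_swap (a := b) (b := a)]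
    exact (h.mem_edges d hd).symm

theorem ClosableCherry.length_eq_one_of_isPath {a b c : V} (h : ClosableCherry G a b c)
    {p : G.Walk a b} (hp : p.IsPath) (hc : c ∉ p.support) : p.length = 1 := by
  by_contra hp1
  have hab : s(a, b) ∉ p.edges := fun he => hp1 (hp.length_eq_one_of_mem_edges he)
  have hcyc : (Walk.cons h.adj_left.1.symm p).IsCycle :=
    (Walk.cons_isCycle_iff _ _).2 ⟨hp, by rwa [Sym2.eq_swap]⟩
  obtain ⟨d, hd, -, hsupp⟩ := exists_isCycle_evenPart hcyc List.mem_cons_self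
    h.adj_left.symm
  have hcd := d.snd_mem_support_of_mem_edges (h.mem_edges d hd).2
  rw [hsupp, Walk.support_cons, List.mem_cons] at hcd
  exact hcd.elim h.adj_right.ne' hc

theorem ClosableCherry.length_le_two_of_isPath {a b c : V} (h : ClosableCherry G a b c)
    {p : G.Walk a c} (hp : p.IsPath) : p.length ≤ 2 := by
  classical
  by_cases hb : b ∈ p.support
  · have hspec := p.take_spec hb
    have htake := h.length_eq_one_of_isPath (hp.takeUntil hb)
      (Walk.endpoint_notMem_support_takeUntil hp hb h.adj_right.ne')
    have hdrop := h.symm.length_eq_one_of_isPath (hp.dropUntil hb).reverse fun ha =>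
      (hspec.symm ▸ hp).ne_of_mem_support_of_append h.adj_left.ne (Walk.start_mem_support _)
        (by simpa using ha) rfl
    rw [Walk.length_reverse] at hdrop
    rw [← hspec, Walk.length_append]
    omega
  · have hcyc : (Walk.cons h.adj_left.1.symm (p.concat h.adj_right.1.symm)).IsCycle := by
      refine (Walk.cons_isCycle_iff _ _).2 ⟨hp.concat hb _, ?_⟩
      rw [Walk.edges_concat, List.concat_eq_append, List.mem_append, List.mem_singleton]
      rintro (hba | hba)
      · exact hb (p.fst_mem_support_of_mem_edges hba)
      · rw [Sym2.eq_swap, Sym2.congr_left] at hba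
        exact h.ne hba
    obtain ⟨d, hd, hedges, -⟩ := exists_isCycle_evenPart hcyc List.mem_cons_self
      h.adj_left.symm
    have hlen := h.length_le d hd
    rw [← Walk.length_edges, hedges, Walk.length_edges, Walk.length_cons, Walk.length_concat]
      at hlen
    omega

theorem FamilyFree.sup_edge {m : ℕ} {a c : V} (hG : FamilyFree (oddCyclesGE m) G)
    (hpath : ∀ p : G.Walk a c, p.IsPath → p.length + 1 < m) :
    FamilyFree (oddCyclesGE m) (G ⊔ edge a c) := by
  rw [familyFree_oddCyclesGE_iff] at hG ⊢
  intro r d hd hodd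
  have hsub {u v : V} {p : (G ⊔ edge a c).Walk u v} (hac : s(a, c) ∉ p.edges) :
      ∀ e ∈ p.edges, e ∈ G.edgeSet := by
    intro e he
    have hne : e ≠ s(a, c) := fun h => hac (h ▸ he)
    have := p.edges_subset_edgeSet he
    induction e with | _ x y =>
    simp only [mem_edgeSet, sup_adj, edge_adj, ne_eq, Sym2.eq_iff] at *
    tauto
  by_cases hac : s(a, c) ∈ d.edges
  · obtain ⟨p, hp, hp_edge, hperm⟩ := exists_isPath_perm_edges_of_isCycle hd hac
    have hlen : d.length = p.length + 1 := by simpa using hperm.length_eq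
    simpa [hlen] using hpath _ (hp.transfer (hsub hp_edge)).reverse
  · simpa using hG r _ (hd.transfer (hsub hac)) (by simpa using hodd)

theorem ClosableCherry.not_adj {a b c : V} (h : ClosableCherry G a b c) : ¬G.Adj a c := fun hac =>
  (evenPart_adj.1 h.adj_left).2 (onOddCycle_of_triangle h.adj_left.1 h.adj_right.1 hac.symm)

theorem ClosableCherry.legalMove {m : ℕ} (hm : 4 ≤ m) (hG : FamilyFree (oddCyclesGE m) G)
    {a b c : V} (h : ClosableCherry G a b c) :
    LegalMove (oddCyclesGE m) G (G ⊔ edge a c) := by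
  refine ⟨a, c, h.ne, h.not_adj, rfl, hG.sup_edge fun p hp => ?_⟩
  have := h.length_le_two_of_isPath hp
  omega

theorem exists_closableCherry {e : Sym2 V} (h3 : TrailsLE ((evenPart G).deleteEdges {e}) 3)
    (h1 : ¬TrailsLE (evenPart G) 1) :
    ∃ a b c, ClosableCherry G a b c ∧
      TrailsLE ((evenPart G).deleteEdges {s(a, b), s(b, c)}) 3 := by
  have hacyclic := h3.isAcyclic_of_le_evenPart (deleteEdges_le _)
  by_cases hG : TrailsLE (evenPart G) 3
  · have hforest := hG.isAcyclic_of_le_evenPart le_rfl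
    simp only [TrailsLE, not_forall, not_le] at h1
    obtain ⟨u, v, p, hp, hlen⟩ := h1
    obtain ⟨f, hf⟩ := List.exists_mem_of_length_pos (l := p.edges) (by rw [p.length_edges]; omega)
    obtain ⟨a, b, c, hac, hab, hbc, -⟩ := exists_cherry_of_isTrail hp hlen hf
    exact ⟨a, b, c, ⟨p.adj_of_mem_edges hab, p.adj_of_mem_edges hbc, hac,
      fun _ d hd => (hforest d hd).elim, fun _ d hd => (hforest d hd).elim⟩,
      hG.anti (deleteEdges_le _)⟩
  -- Every cycle of the even part passes through `e`, and is unique because removing `e` leaves a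
  -- forest. So a cherry containing `e` and taken on that cycle, if there is one, meets the demands.
  · obtain ⟨u, v, p, hp, hlen, hcyc⟩ : ∃ (u v : V) (p : (evenPart G).Walk u v), p.IsTrail ∧
        3 < p.length ∧ ∀ ⦃r : V⦄ (d : (evenPart G).Walk r r), d.IsCycle → p.edges ⊆ d.edges := by
      by_cases hforest : (evenPart G).IsAcyclic
      · simp only [TrailsLE, not_forall, not_le] at hG
        obtain ⟨u, v, p, hp, hlen⟩ := hG
        exact ⟨u, v, p, hp, hlen, fun _ d hd => (hforest d hd).elim⟩
      · simp only [IsAcyclic, not_forall, not_not] at hforest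
        obtain ⟨u, p, hp⟩ := hforest
        exact ⟨u, u, p, hp.isTrail, four_le_length_of_isCycle_evenPart hp, fun _ d hd =>
          (perm_edges_of_isCycle_of_isAcyclic_deleteEdges hacyclic hp hd).subset⟩
    have he : e ∈ p.edges := by_contra fun he => (h3.length_le hp he).not_gt hlen
    obtain ⟨a, b, c, hac, hab, hbc, rfl⟩ := exists_cherry_of_isTrail hp (by omega) he
    exact ⟨a, b, c, ⟨p.adj_of_mem_edges hab, p.adj_of_mem_edges hbc, hac,
      fun _ d hd => h3.length_le_add_one_of_isCycle hd,
      fun _ d hd => ⟨hcyc d hd hab, hcyc d hd hbc⟩⟩,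
      h3.anti (deleteEdges_anti (by simp))⟩

/-- The property of the position that Mini restores after each of Max's moves, in the game whose
forbidden graphs are the odd cycles of length at least `m`. -/
structure MiniInvariant (m : ℕ) (G : SimpleGraph V) : Prop where
  familyFree : FamilyFree (oddCyclesGE m) G
  trailsLE : TrailsLE (evenPart G) 3

theorem miniInvariant_bot (m : ℕ) : MiniInvariant m (⊥ : SimpleGraph V) where
  familyFree := familyFree_oddCyclesGE_iff.2 fun _ c hc _ => (isAcyclic_bot c hc).elim
  trailsLE u v p _ := by
    cases p with
    | nil => simp
    | cons h _ => exact (evenPart_le h).elim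

theorem MiniInvariant.exists_reply {m : ℕ} (hm : 4 ≤ m) (hG : MiniInvariant m G)
    (hGH : LegalMove (oddCyclesGE m) G H) :
    (∃ K, LegalMove (oddCyclesGE m) H K ∧ MiniInvariant m K) ∨
      (¬∃ K, LegalMove (oddCyclesGE m) H K) ∧ MiniInvariant m H := by
  obtain ⟨u, v, -, -, rfl, hfree⟩ := hGH
  -- Over a matching any move will do: a new edge extends trails of length one to length three.
  by_cases h1 : TrailsLE (evenPart (G ⊔ edge u v)) 1
  · by_cases hmove : ∃ K, LegalMove (oddCyclesGE m) (G ⊔ edge u v) K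
    · obtain ⟨K, hK⟩ := hmove
      obtain ⟨x, y, -, -, rfl, hfree'⟩ := id hK
      exact .inl ⟨_, hK, hfree', (h1.anti (deleteEdges_evenPart_sup_edge_le x y)).two_mul_add_one⟩
    · exact .inr ⟨hmove, hfree, fun u v p hp => (h1 p hp).trans (by omega)⟩
  · obtain ⟨a, b, c, hcherry, htrails⟩ := exists_closableCherry
      (hG.trailsLE.anti (deleteEdges_evenPart_sup_edge_le u v)) h1
    have hmove := hcherry.legalMove hm hfree
    obtain ⟨-, -, -, -, -, hfree'⟩ := id hmove
    exact .inl ⟨_, hmove, hfree', htrails.anti <| evenPart_sup_edge_le_of_cherry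
      hcherry.adj_left.1 hcherry.adj_right.1 hcherry.ne⟩

theorem edgeSet_inter_sym2_subset (S : Set V) (v : V) :
    G.edgeSet ∩ S.sym2 ⊆
      (G.edgeSet ∩ (S \ {v}).sym2) ∪ (fun w => s(v, w)) '' (G.neighborSet v ∩ S) := by
  rintro e ⟨he, heS⟩
  by_cases hv : v ∈ e
  · obtain ⟨w, rfl⟩ := hv
    exact .inr ⟨w, ⟨he, heS.2⟩, rfl⟩
  · rw [Set.mem_sym2_iff_subset] at heS
    refine .inl ⟨he, Set.mem_sym2_iff_subset.2 fun x hx => ⟨heS hx, ?_⟩⟩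
    rintro rfl
    exact hv hx

theorem ncard_edgeSet_le_of_degenerate [Finite V] {d : ℕ}
    (h : ∀ S : Set V, S.Nonempty → ∃ v ∈ S, (G.neighborSet v ∩ S).ncard ≤ d) :
    G.edgeSet.ncard ≤ d * (Nat.card V - 1) := by
  suffices key : ∀ S : Set V, (G.edgeSet ∩ S.sym2).ncard ≤ d * (S.ncard - 1) by
    simpa [Set.ncard_univ] using key Set.univ
  intro S
  induction hn : S.ncard using Nat.strong_induction_on generalizing S with
  | _ n ih =>
  obtain rfl | hS := S.eq_empty_or_nonempty
  · simp
  obtain ⟨v, hv, hdeg⟩ := h S hS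
  have hcard : (S \ {v}).ncard + 1 = n := hn ▸ Set.ncard_sdiff_singleton_add_one hv
  have hdeg' : (G.neighborSet v ∩ S).ncard ≤ n - 1 := by
    rw [← hcard, Nat.add_sub_cancel]
    exact Set.ncard_le_ncard fun w hw => ⟨hw.2, hw.1.ne'⟩
  have hdeg_le : (G.neighborSet v ∩ S).ncard ≤ d * (n - 1 - (n - 1 - 1)) := by
    obtain h0 | h1 := Nat.eq_zero_or_pos (n - 1)
    · omega
    · rwa [show n - 1 - (n - 1 - 1) = 1 by omega, mul_one]
  calc (G.edgeSet ∩ S.sym2).ncard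
      ≤ (G.edgeSet ∩ (S \ {v}).sym2).ncard + (G.neighborSet v ∩ S).ncard :=
        (Set.ncard_le_ncard (edgeSet_inter_sym2_subset S v)).trans <|
          (Set.ncard_union_le _ _).trans (Nat.add_le_add_left Set.ncard_image_le _)
    _ ≤ d * (n - 1 - 1) + d * (n - 1 - (n - 1 - 1)) :=
        add_le_add (ih (n - 1) (by omega) _ (by omega)) hdeg_le
    _ = d * (n - 1) := by rw [← mul_add]; congr 1; omega

theorem exists_isPath_neighborSet_inter_subset_support [Finite V] {S : Set V} (hS : S.Nonempty) :
    ∃ u ∈ S, ∃ (v : V) (p : G.Walk u v), p.IsPath ∧ ∀ w ∈ G.neighborSet u ∩ S, w ∈ p.support := by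
  have := hS.to_subtype
  obtain ⟨u, v, p, hp, hmax⟩ := Walk.exists_isPath_forall_isPath_length_le_length (G.induce S)
  let f := (Embedding.induce (G := G) S).toHom
  refine ⟨f u, u.2, f v, p.map f, hp.map Subtype.val_injective, fun w ⟨hadj, hw⟩ => ?_⟩
  by_contra hnot
  have hcons : (Walk.cons (show (G.induce S).Adj ⟨w, hw⟩ u from hadj.symm) p).IsPath :=
    hp.cons fun hmem => hnot (by
      rw [Walk.support_map]
      exact List.mem_map_of_mem hmem)
  exact (hmax _ _ _ hcons).not_gt (by simp)

theorem exists_isCycle_length_eq_of_adj_getVert {u v : V} {p : G.Walk u v} (hp : p.IsPath) {i : ℕ}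
    (h2 : 2 ≤ i) (hi : i ≤ p.length) (hadj : G.Adj u (p.getVert i)) :
    ∃ c : G.Walk (p.getVert i) (p.getVert i), c.IsCycle ∧ c.length = i + 1 := by
  have hlen : (p.take i).length = i := by simp [hi]
  refine ⟨.cons hadj.symm (p.take i),
    (Walk.cons_isCycle_iff _ _).2 ⟨hp.take i, fun h => ?_⟩, by rw [Walk.length_cons, hlen]⟩
  have := (hp.take i).length_eq_one_of_mem_edges (Sym2.eq_swap ▸ h)
  omega

theorem exists_mem_ncard_neighborSet_inter_le [Finite V] {k : ℕ} (hk : 1 ≤ k)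
    (hodd : ∀ (u : V) (c : G.Walk u u), c.IsCycle → Odd c.length → c.length < 2 * k + 1)
    (heven : ∀ (u : V) (c : G.Walk u u), c.IsCycle → Even c.length → c.length < 4 * k)
    {S : Set V} (hS : S.Nonempty) : ∃ v ∈ S, (G.neighborSet v ∩ S).ncard ≤ 3 * k - 2 := by
  classical
  obtain ⟨u, hu, v, p, hp, hnbr⟩ := exists_isPath_neighborSet_inter_subset_support (G := G) hS
  -- A chord to the `i`-th vertex of the path closes a cycle of length `i + 1`, so `i` is either odd
  -- and at most `4k - 3`, or even and at most `2k - 2`.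
  let I := (Finset.range (2 * k - 1)).image (2 * · + 1) ∪ (Finset.range (k - 1)).image (2 * · + 2)
  have hsub : G.neighborSet u ∩ S ⊆ I.image p.getVert := by
    intro w hw
    obtain ⟨i, rfl, hi⟩ := Walk.mem_support_iff_exists_getVert.1 (hnbr w hw)
    have hadj : G.Adj u (p.getVert i) := hw.1
    have hi0 : i ≠ 0 := by
      rintro rfl
      simp at hadj
    refine Finset.mem_coe.2 (Finset.mem_image_of_mem _ ?_)
    simp only [I, Finset.mem_union, Finset.mem_image, Finset.mem_range]
    obtain rfl | h2 : i = 1 ∨ 2 ≤ i := by omega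
    · exact .inl ⟨0, by omega⟩
    obtain ⟨c, hc, hlen⟩ := exists_isCycle_length_eq_of_adj_getVert hp h2 hi hadj
    rcases Nat.even_or_odd' i with ⟨j, rfl | rfl⟩
    · have := hodd _ c hc ⟨j, hlen⟩
      exact .inr ⟨j - 1, by omega⟩
    · have := heven _ c hc ⟨j + 1, by omega⟩
      exact .inl ⟨j, by omega⟩
  refine ⟨u, hu, ?_⟩
  calc (G.neighborSet u ∩ S).ncard
      ≤ (I.image p.getVert).card := (Set.ncard_le_ncard hsub).trans_eq (Set.ncard_coe_finset _)
    _ ≤ I.card := Finset.card_image_le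
    _ ≤ (2 * k - 1) + (k - 1) := (Finset.card_union_le _ _).trans <| add_le_add
        (Finset.card_image_le.trans_eq (Finset.card_range _))
        (Finset.card_image_le.trans_eq (Finset.card_range _))
    _ = 3 * k - 2 := by omega

theorem MiniInvariant.length_lt_of_even {k : ℕ} (hk : 1 ≤ k) (hG : MiniInvariant (2 * k + 1) G)
    {r : V} {c : G.Walk r r} (hc : c.IsCycle) (heven : Even c.length) : c.length < 4 * k := by
  by_cases hodd : ∃ e ∈ c.edges, OnOddCycle G e
  · obtain ⟨e, he, heodd⟩ := hodd
    obtain ⟨x, d₁, d₂, hd₁, hd₂, hlen, -⟩ :=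
      exists_odd_isCycle_cover_of_even_isCycle hc heven he heodd
    have hfree := familyFree_oddCyclesGE_iff.1 hG.familyFree x
    have h₁ := hfree d₁ hd₁.1 hd₁.2
    have h₂ := hfree d₂ hd₂.1 hd₂.2
    omega
  · push Not at hodd
    have hsub : ∀ e ∈ c.edges, e ∈ (evenPart G).edgeSet := fun e he =>
      mem_edgeSet_evenPart.2 ⟨c.edges_subset_edgeSet he, hodd e he⟩
    have := hG.trailsLE _ (hc.transfer hsub).isTrail
    rw [Walk.length_transfer] at this
    omega

theorem MiniInvariant.ncard_edgeSet_le [Finite V] {k : ℕ} (hk : 1 ≤ k)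
    (hG : MiniInvariant (2 * k + 1) G) : G.edgeSet.ncard ≤ (3 * k - 2) * (Nat.card V - 1) :=
  ncard_edgeSet_le_of_degenerate fun _ => exists_mem_ncard_neighborSet_inter_le hk
    (familyFree_oddCyclesGE_iff.1 hG.familyFree) fun _ _ => hG.length_lt_of_even hk

theorem gameScore_max_le [Finite V] {𝓕 : GraphFamily} {N : ℕ}
    (hend : (¬∃ H, LegalMove 𝓕 G H) → G.edgeSet.ncard ≤ N)
    (hmove : ∀ H, LegalMove 𝓕 G H → gameScore 𝓕 Player.mini H ≤ N) :
    gameScore 𝓕 Player.max G ≤ N := by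
  rw [gameScore]
  split_ifs with h
  · have := nonempty_subtype.2 h
    exact ciSup_le fun H => hmove H.1 H.2
  · exact hend h

theorem gameScore_mini_le_of_legalMove [Finite V] {𝓕 : GraphFamily} {N : ℕ}
    (hGH : LegalMove 𝓕 G H) (hH : gameScore 𝓕 Player.max H ≤ N) :
    gameScore 𝓕 Player.mini G ≤ N := by
  rw [gameScore, if_pos ⟨H, hGH⟩]
  exact (ciInf_le (OrderBot.bddBelow _)
    (⟨H, hGH⟩ : {H : SimpleGraph V // LegalMove 𝓕 G H})).trans hH

theorem gameScore_mini_of_not_exists_legalMove [Finite V] {𝓕 : GraphFamily}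
    (hG : ¬∃ H, LegalMove 𝓕 G H) : gameScore 𝓕 Player.mini G = G.edgeSet.ncard := by
  rw [gameScore, if_neg hG]

theorem gameScore_max_le_of_invariant [Finite V] {𝓕 : GraphFamily} {N : ℕ}
    {P : SimpleGraph V → Prop}
    (hend : ∀ G, P G → (¬∃ H, LegalMove 𝓕 G H) → G.edgeSet.ncard ≤ N)
    (hreply : ∀ G H, P G → LegalMove 𝓕 G H →
      (∃ K, LegalMove 𝓕 H K ∧ P K) ∨ (¬∃ K, LegalMove 𝓕 H K) ∧ P H)
    (hG : P G) : gameScore 𝓕 Player.max G ≤ N := by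
  induction hn : (Gᶜ).edgeSet.ncard using Nat.strong_induction_on generalizing G with
  | _ n ih =>
  refine gameScore_max_le (hend G hG) fun H hGH => ?_
  obtain ⟨K, hHK, hK⟩ | ⟨hstuck, hH⟩ := hreply G H hG hGH
  · have hlt := hHK.ncard_compl_lt.trans hGH.ncard_compl_lt
    exact gameScore_mini_le_of_legalMove hHK (ih _ (hn ▸ hlt) hK rfl)
  · exact (gameScore_mini_of_not_exists_legalMove hstuck).trans_le (hend H hH hstuck)

theorem corollary1p4_general (k n : ℕ) (hk : 2 ≤ k) (hn : 1 ≤ n) :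
    (gameSaturationNumber n (oddCyclesGE (2 * k + 1)) : ℤ) ≤
      (3 * (k : ℤ) - 2) * ((n : ℤ) - 1) := by
  have hscore : gameSaturationNumber n (oddCyclesGE (2 * k + 1)) ≤ (3 * k - 2) * (n - 1) := by
    refine gameScore_max_le_of_invariant (P := MiniInvariant (2 * k + 1)) (fun G hG _ => ?_)
      (fun _ _ hG hGH => hG.exists_reply (by omega) hGH) (miniInvariant_bot _)
    simpa using hG.ncard_edgeSet_le (by omega)
  zify [hn, show 2 ≤ 3 * k by omega] at hscore
  exact hscore

theorem corollary1p4 (k n : ℕ) (hk : 2 ≤ k) (hn : 1 ≤ n) :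
    (gameSaturationNumber n (oddCyclesGE (2 * k + 1)) : ℤ) ≤ (3 * (k : ℤ) + 1) * ((n : ℤ) - 1) :=
  (corollary1p4_general k n hk hn).trans <| by gcongr <;> omega
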